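/- For a topological space $Y$, let $\dim Y \in \{-1,0,1,2,\dots\}\cup\{\infty\}$ denote its covering dimension: $\dim Y=-1$ if $Y$ is empty; for nonempty $Y$, $\dim Y$ is the least integer $n\ge 0$ such that every open cover of $Y$ has an open refinement covering $Y$ in which any $n+2$ different members have empty intersection, and $\dim Y=\infty$ if there is no such $n$. Theorem 5.10. Let $X$ be a metrizable space and let $A$ and $B$ be subsets of $X$, each subset of $X$ being given the subspace topology. Then $$\dim(A\cup B)\le \dim(A)+\dim(B)+1,$$ where a sum with an infinite term is $\infty$. -/

import Mathlib

/-- `𝒰` is an open cover of the space `X`. -/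
def IsOpenCoverOf {X : Type*} [TopologicalSpace X] (𝒰 : Set (Set X)) : Prop :=
  (∀ U ∈ 𝒰, IsOpen U) ∧ ⋃₀ 𝒰 = Set.univ

/-- `ord 𝒱 ≤ n`: any `n + 2` different elements of `𝒱` have empty intersection. -/
def CoverOrderLE {X : Type*} (𝒱 : Set (Set X)) (n : ℕ) : Prop :=
  ∀ t : Finset (Set X), (t : Set (Set X)) ⊆ 𝒱 → t.card = n + 2 →
    ⋂₀ (t : Set (Set X)) = ∅

/-- `dim X ≤ n` for `n ≥ 0`: every open cover of `X` has an open refinement (again a cover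
of `X`) of order at most `n`. -/
def CoveringDimLE (X : Type*) [TopologicalSpace X] (n : ℕ) : Prop :=
  ∀ 𝒰 : Set (Set X), IsOpenCoverOf 𝒰 →
    ∃ 𝒱 : Set (Set X), IsOpenCoverOf 𝒱 ∧ (∀ V ∈ 𝒱, ∃ U ∈ 𝒰, V ⊆ U) ∧ CoverOrderLE 𝒱 n

open Classical in
/-- The covering dimension of a space, with values in `{-1, 0, 1, 2, …} ∪ {∞}`: it is `-1` for
the empty space; otherwise it is the least `n ≥ 0` such that `dim X ≤ n`, and `∞` (written `⊤`)
if there is no such `n`. -/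
noncomputable def coveringDim (X : Type*) [TopologicalSpace X] : WithTop ℤ :=
  if IsEmpty X then ((-1 : ℤ) : WithTop ℤ)
  else if h : ∃ n : ℕ, CoveringDimLE X n then ((Nat.find h : ℤ) : WithTop ℤ)
  else ⊤

open Set TopologicalSpace

/-! Work in the metric space `A ∪ B`. Refine a cover separately over `A` and over `B`, extend both
families to open sets of `A ∪ B` without raising their orders `m` and `n`, and take the union.
Orders then add up to `m + n + 1` by pigeonhole (`CoverOrderLE.union`). The metric serves only for
the extension. -/

/-- An open cover of a metric space `Y` has, over a subspace of dimension at most `n`, an open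
refinement of order at most `n` in `Y`. -/
theorem CoveringDimLE.exists_open_refinement_of_isInducing {Z Y : Type*} [TopologicalSpace Z]
    [MetricSpace Y] {f : Z → Y} (hf : Topology.IsInducing f) {n : ℕ} (hn : CoveringDimLE Z n)
    {𝒰 : Set (Set Y)} (h𝒰 : IsOpenCoverOf 𝒰) :
    ∃ 𝒱 : Set (Set Y), (∀ V ∈ 𝒱, IsOpen V) ∧ range f ⊆ ⋃₀ 𝒱 ∧
      (∀ V ∈ 𝒱, ∃ U ∈ 𝒰, V ⊆ U) ∧ CoverOrderLE 𝒱 n := by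
  classical
  have hpull : IsOpenCoverOf ((fun U : Set Y => f ⁻¹' U) '' 𝒰) := by
    refine ⟨?_, eq_univ_of_forall fun z => ?_⟩
    · rintro _ ⟨U, hU, rfl⟩
      exact (h𝒰.1 U hU).preimage hf.continuous
    · obtain ⟨U, hU, hz⟩ := mem_sUnion.1 (h𝒰.2 ▸ mem_univ (f z))
      exact ⟨_, ⟨U, hU, rfl⟩, hz⟩
  obtain ⟨𝒲, ⟨h𝒲o, h𝒲c⟩, h𝒲r, h𝒲n⟩ := hn _ hpull
  have hex : ∀ W : Set Z, ∃ U : Set Y, W ∈ 𝒲 → U ∈ 𝒰 ∧ W ⊆ f ⁻¹' U := by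
    intro W
    by_cases hW : W ∈ 𝒲
    · obtain ⟨_, ⟨U, hU, rfl⟩, hWU⟩ := h𝒲r W hW
      exact ⟨U, fun _ => ⟨hU, hWU⟩⟩
    · exact ⟨∅, fun h => absurd h hW⟩
  choose u hu using hex
  -- Halving the radii ensures that finitely many `e W` meet only if the sets `W` themselves meet.
  let e : Set Z → Set Y := fun W =>
    {y | ∃ z r, f ⁻¹' Metric.ball (f z) (2 * r) ⊆ W ∧ dist y (f z) < r}
  have he_open : ∀ W, IsOpen (e W) := by
    intro W
    have : e W = ⋃ (z : Z) (r : ℝ) (_ : f ⁻¹' Metric.ball (f z) (2 * r) ⊆ W),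
        Metric.ball (f z) r := by
      ext y
      simp [e]
    rw [this]
    exact isOpen_iUnion fun _ => isOpen_iUnion fun _ => isOpen_iUnion fun _ => Metric.isOpen_ball
  have he_mem : ∀ W ∈ 𝒲, ∀ z ∈ W, f z ∈ e W := by
    intro W hW z hz
    obtain ⟨r, hr, hrW⟩ := (hf.basis_nhds Metric.nhds_basis_ball).mem_iff.1
      ((h𝒲o W hW).mem_nhds hz)
    refine ⟨z, r / 2, ?_, by simpa using hr⟩
    rwa [mul_div_cancel₀ r two_ne_zero]
  refine ⟨(fun W => e W ∩ u W) '' 𝒲, ?_, ?_, ?_, ?_⟩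
  · rintro _ ⟨W, hW, rfl⟩
    exact (he_open W).inter (h𝒰.1 _ (hu W hW).1)
  · rintro _ ⟨z, rfl⟩
    obtain ⟨W, hW, hz⟩ := mem_sUnion.1 (h𝒲c ▸ mem_univ z)
    exact ⟨_, ⟨W, hW, rfl⟩, he_mem W hW z hz, (hu W hW).2 hz⟩
  · rintro _ ⟨W, hW, rfl⟩
    exact ⟨u W, (hu W hW).1, inter_subset_right⟩
  · intro t ht htn
    -- Different `W` may give the same `e W ∩ u W`, so one `W` is chosen for each member of `t`.
    obtain ⟨s, hs, hinj, rfl⟩ := Finset.exists_subset_injOn_image_eq_of_surjOn 𝒲 t ht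
    rw [Finset.card_image_of_injOn hinj] at htn
    by_contra hne
    obtain ⟨y, hy⟩ := nonempty_iff_ne_empty.2 hne
    have hye : ∀ W ∈ s, y ∈ e W := fun W hW =>
      (hy _ (Finset.mem_coe.2 (Finset.mem_image_of_mem _ hW))).1
    choose! z r hzr hd using hye
    -- the centre whose radius is least lies in every member of `s`
    obtain ⟨W₀, hW₀, hmin⟩ := s.exists_min_image r (Finset.card_pos.1 (by omega))
    have hmem : z W₀ hW₀ ∈ ⋂₀ (s : Set (Set Z)) := by
      intro W hW
      refine hzr W hW ?_
      have h₁ := dist_triangle_left (f (z W₀ hW₀)) (f (z W hW)) y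
      have h₂ := hd W₀ hW₀
      have h₃ := hd W hW
      have h₄ := hmin W hW
      simp only [mem_preimage, Metric.mem_ball]
      linarith
    rw [h𝒲n s hs htn] at hmem
    exact hmem

/-- Of `m + n + 3` members, either `m + 2` lie in `𝒱` or at least `n + 2` lie outside it, hence in
`𝒲`. -/
theorem CoverOrderLE.union {Y : Type*} {𝒱 𝒲 : Set (Set Y)} {m n : ℕ}
    (h𝒱 : CoverOrderLE 𝒱 m) (h𝒲 : CoverOrderLE 𝒲 n) : CoverOrderLE (𝒱 ∪ 𝒲) (m + n + 1) := by
  classical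
  have sub : ∀ {𝒯 : Set (Set Y)} {k : ℕ}, CoverOrderLE 𝒯 k → ∀ t s : Finset (Set Y), s ⊆ t →
      (s : Set (Set Y)) ⊆ 𝒯 → k + 2 ≤ s.card → ⋂₀ (t : Set (Set Y)) = ∅ := by
    intro 𝒯 k h𝒯 t s hst hs hk
    obtain ⟨s', hs', hcard⟩ := Finset.exists_subset_card_eq hk
    refine subset_empty_iff.1 ?_
    rw [← h𝒯 s' ((Finset.coe_subset.2 hs').trans hs) hcard]
    exact sInter_subset_sInter (Finset.coe_subset.2 (hs'.trans hst))
  intro t ht hcard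
  have hsum := Finset.card_filter_add_card_filter_not (s := t) (· ∈ 𝒱)
  rcases le_or_gt (m + 2) (t.filter (· ∈ 𝒱)).card with h | h
  · exact sub h𝒱 t _ (Finset.filter_subset _ _) (fun W hW => (Finset.mem_filter.1 hW).2) h
  · refine sub h𝒲 t (t.filter (¬ · ∈ 𝒱)) (Finset.filter_subset _ _) (fun W hW => ?_) (by omega)
    have hW' := Finset.mem_filter.1 hW
    exact (ht hW'.1).resolve_left hW'.2

theorem CoveringDimLE.union {X : Type*} [TopologicalSpace X] [MetrizableSpace X] {A B : Set X}
    {m n : ℕ} (hA : CoveringDimLE A m) (hB : CoveringDimLE B n) :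
    CoveringDimLE ↥(A ∪ B) (m + n + 1) := by
  let _ := metrizableSpaceMetric X
  intro 𝒰 h𝒰
  obtain ⟨𝒱, h𝒱o, h𝒱c, h𝒱r, h𝒱m⟩ := hA.exists_open_refinement_of_isInducing
    (Topology.IsEmbedding.inclusion (subset_union_left (s := A) (t := B))).isInducing h𝒰
  obtain ⟨𝒲, h𝒲o, h𝒲c, h𝒲r, h𝒲n⟩ := hB.exists_open_refinement_of_isInducing
    (Topology.IsEmbedding.inclusion (subset_union_right (s := A) (t := B))).isInducing h𝒰
  refine ⟨𝒱 ∪ 𝒲, ⟨?_, ?_⟩, ?_, h𝒱m.union h𝒲n⟩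
  · rintro V (hV | hV)
    exacts [h𝒱o V hV, h𝒲o V hV]
  · rw [sUnion_union]
    refine eq_univ_of_forall ?_
    rintro ⟨x, hx | hx⟩
    · exact Or.inl (h𝒱c ⟨⟨x, hx⟩, rfl⟩)
    · exact Or.inr (h𝒲c ⟨⟨x, hx⟩, rfl⟩)
  · rintro V (hV | hV)
    exacts [h𝒱r V hV, h𝒲r V hV]

theorem coveringDim_of_isEmpty (Y : Type*) [TopologicalSpace Y] [h : IsEmpty Y] :
    coveringDim Y = ((-1 : ℤ) : WithTop ℤ) := if_pos h

theorem CoveringDimLE.coveringDim_le {Y : Type*} [TopologicalSpace Y] {n : ℕ}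
    (h : CoveringDimLE Y n) : coveringDim Y ≤ ((n : ℤ) : WithTop ℤ) := by
  classical
  unfold coveringDim
  split_ifs with h₁ h₂
  · exact WithTop.coe_le_coe.2 (by omega)
  · exact WithTop.coe_le_coe.2 (Int.ofNat_le.2 (Nat.find_min' _ h))
  · exact absurd ⟨n, h⟩ h₂

theorem coveringDim_eq_top_or_exists (Y : Type*) [TopologicalSpace Y] [Nonempty Y] :
    coveringDim Y = ⊤ ∨ ∃ n : ℕ, CoveringDimLE Y n ∧ coveringDim Y = ((n : ℤ) : WithTop ℤ) := by
  classical
  unfold coveringDim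
  rw [if_neg (not_isEmpty_of_nonempty Y)]
  split_ifs with h
  · exact Or.inr ⟨_, Nat.find_spec h, rfl⟩
  · exact Or.inl rfl

theorem WithTop.neg_one_add_add_one (d : WithTop ℤ) : ((-1 : ℤ) : WithTop ℤ) + d + 1 = d := by
  induction d with
  | top => simp
  | coe d => exact congrArg WithTop.some (by ring)

theorem theorem5p10 {X : Type*} [TopologicalSpace X] [TopologicalSpace.MetrizableSpace X]
    (A B : Set X) :
    coveringDim ↥(A ∪ B) ≤ coveringDim ↥A + coveringDim ↥B + 1 := by
  -- The value `-1` escapes the natural-number bounds, but there it cancels the `+ 1` and equality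
  -- holds.
  rcases A.eq_empty_or_nonempty with rfl | hA
  · rw [coveringDim_of_isEmpty ↥(∅ : Set X), WithTop.neg_one_add_add_one, empty_union]
  rcases B.eq_empty_or_nonempty with rfl | hB
  · rw [coveringDim_of_isEmpty ↥(∅ : Set X), add_comm (coveringDim ↥A),
      WithTop.neg_one_add_add_one, union_empty]
  have := hA.to_subtype
  have := hB.to_subtype
  rcases coveringDim_eq_top_or_exists A with h | ⟨m, hm, h⟩
  · simp [h]
  rcases coveringDim_eq_top_or_exists B with h' | ⟨n, hn, h'⟩
  · simp [h']
  rw [h, h']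
  refine (hm.union hn).coveringDim_le.trans_eq ?_
  push_cast
  rfl
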